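/- Let $\ell_1$ be the real Banach space of absolutely summable real sequences $(x_n)_{n\in\mathbb{N}}$, with norm $\|x\|=\sum_n |x_n|$ and standard basis $(e_n)$, and let $$\mathbb{Z}_{\ell_1}=\Big\{\sum_{n=1}^N a_n e_n : N\in\mathbb{N},\ a_1,\dots,a_N\in\mathbb{Z}\Big\}\subset\ell_1$$ be its integer grid, endowed with the metric inherited from $\ell_1$. For a metric space $M$ with base point $0$, let $\mathrm{Lip}_0(M)$ denote the Banach space of all Lipschitz functions $f:M\to\mathbb{R}$ with $f(0)=0$, normed by the best Lipschitz constant $\|f\|=\sup\{(f(x)-f(y))/d(x,y) : x\neq y\in M\}$. Taking the origin as base point of both $\mathbb{Z}_{\ell_1}$ and $\ell_1$, the spaces $\mathrm{Lip}_0(\mathbb{Z}_{\ell_1})$ and $\mathrm{Lip}_0(\ell_1)$ are linearly isomorphic as Banach spaces, i.e. there is a bounded linear bijection with bounded inverse between them. -/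

import Mathlib

noncomputable section

/-- The vector space of real-valued Lipschitz functions on `M` vanishing at the base point `p`. -/
def lipSubmodule (M : Type*) [MetricSpace M] (p : M) : Submodule ℝ (M → ℝ) where
  carrier := {f | (∃ K : NNReal, LipschitzWith K f) ∧ f p = 0}
  zero_mem' := ⟨⟨0, LipschitzWith.const 0⟩, rfl⟩
  add_mem' := by
    rintro f g ⟨⟨K, hK⟩, hf⟩ ⟨⟨L, hL⟩, hg⟩
    exact ⟨⟨K + L, hK.add hL⟩, by simp [hf, hg]⟩
  smul_mem' := by
    rintro c f ⟨⟨K, hK⟩, hf⟩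
    refine ⟨⟨‖c‖₊ * K, ?_⟩, by simp [hf]⟩
    exact (lipschitzWith_smul c).comp hK

/-- The Lipschitz space `Lip₀(M)` of the pointed metric space `(M, p)`.  It is a separate type, so
that it carries the topology of the Lipschitz norm and not that of pointwise convergence. -/
def Lip0 (M : Type*) [MetricSpace M] (p : M) : Type _ := lipSubmodule M p

namespace Lip0

variable {M : Type*} [MetricSpace M] {p : M}

instance : AddCommGroup (Lip0 M p) := inferInstanceAs (AddCommGroup (lipSubmodule M p))

instance : Module ℝ (Lip0 M p) := inferInstanceAs (Module ℝ (lipSubmodule M p))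

instance : CoeFun (Lip0 M p) (fun _ => M → ℝ) := ⟨fun f => f.1⟩

/-- The set of difference quotients of a function on `M`. -/
def quotients (f : M → ℝ) : Set ℝ := {r | ∃ x y : M, x ≠ y ∧ r = (f x - f y) / dist x y}

/-- The norm of `Lip₀(M)` is the best Lipschitz constant. -/
instance : Norm (Lip0 M p) := ⟨fun f => sSup (quotients f)⟩

theorem norm_def (f : Lip0 M p) : ‖f‖ = sSup (quotients f) := rfl

theorem bddAbove_quotients (f : Lip0 M p) : BddAbove (quotients f) := by
  obtain ⟨K, hK⟩ := f.2.1
  refine ⟨K, ?_⟩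
  rintro r ⟨x, y, hxy, rfl⟩
  rw [div_le_iff₀ (dist_pos.2 hxy)]
  exact (le_abs_self _).trans ((Real.dist_eq _ _).symm.le.trans (hK.dist_le_mul x y))

protected theorem norm_nonneg' (f : Lip0 M p) : 0 ≤ ‖f‖ := by
  rw [norm_def]
  by_cases h : ∃ x y : M, x ≠ y
  · obtain ⟨x, y, hxy⟩ := h
    have h1 := le_csSup (bddAbove_quotients f) ⟨x, y, hxy, rfl⟩
    have h2 := le_csSup (bddAbove_quotients f) ⟨y, x, hxy.symm, rfl⟩
    rw [dist_comm y x, ← neg_sub, neg_div] at h2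
    linarith
  · have : quotients (f : M → ℝ) = ∅ := by
      ext r
      simp only [Set.mem_empty_iff_false, iff_false]
      rintro ⟨x, y, hxy, -⟩
      exact h ⟨x, y, hxy⟩
    rw [this, Real.sSup_empty]

theorem sub_le_norm_mul (f : Lip0 M p) (x y : M) : f x - f y ≤ ‖f‖ * dist x y := by
  rcases eq_or_ne x y with rfl | hxy
  · simp
  · rw [← div_le_iff₀ (dist_pos.2 hxy)]
    exact le_csSup (bddAbove_quotients f) ⟨x, y, hxy, rfl⟩

theorem norm_le_of_sub_le (f : Lip0 M p) {C : ℝ} (hC : 0 ≤ C)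
    (h : ∀ x y, f x - f y ≤ C * dist x y) : ‖f‖ ≤ C := by
  refine Real.sSup_le ?_ hC
  rintro r ⟨x, y, hxy, rfl⟩
  exact (div_le_iff₀ (dist_pos.2 hxy)).2 (h x y)

theorem norm_smul_le' (c : ℝ) (f : Lip0 M p) : ‖c • f‖ ≤ |c| * ‖f‖ := by
  refine norm_le_of_sub_le _ (mul_nonneg (abs_nonneg c) f.norm_nonneg') fun x y => ?_
  have h1 := f.sub_le_norm_mul x y
  have h2 := f.sub_le_norm_mul y x
  rw [dist_comm y x] at h2
  change c * f x - c * f y ≤ _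
  calc c * f x - c * f y ≤ |c * f x - c * f y| := le_abs_self _
    _ = |c| * |f x - f y| := by rw [← mul_sub, abs_mul]
    _ ≤ |c| * (‖f‖ * dist x y) :=
        mul_le_mul_of_nonneg_left (abs_le.2 ⟨by linarith, h1⟩) (abs_nonneg c)
    _ = |c| * ‖f‖ * dist x y := (mul_assoc _ _ _).symm

theorem core : NormedSpace.Core ℝ (Lip0 M p) where
  norm_nonneg := Lip0.norm_nonneg'
  norm_smul c f := by
    refine le_antisymm (norm_smul_le' c f) ?_
    rw [Real.norm_eq_abs]
    rcases eq_or_ne c 0 with rfl | hc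
    · simpa using Lip0.norm_nonneg' ((0 : ℝ) • f)
    · have h := norm_smul_le' c⁻¹ (c • f)
      rw [inv_smul_smul₀ hc, abs_inv] at h
      have hc' := abs_pos.2 hc
      calc |c| * ‖f‖ ≤ |c| * (|c|⁻¹ * ‖c • f‖) := mul_le_mul_of_nonneg_left h hc'.le
        _ = ‖c • f‖ := mul_inv_cancel_left₀ hc'.ne' _
  norm_triangle f g := by
    refine norm_le_of_sub_le _ (add_nonneg f.norm_nonneg' g.norm_nonneg') fun x y => ?_
    change (f x + g x) - (f y + g y) ≤ _
    have h1 := f.sub_le_norm_mul x y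
    have h2 := g.sub_le_norm_mul x y
    linarith
  norm_eq_zero_iff f := by
    constructor
    · intro h
      refine Subtype.ext (funext fun x => ?_)
      have h1 := f.sub_le_norm_mul x p
      have h2 := f.sub_le_norm_mul p x
      have h3 : f p = 0 := f.2.2
      rw [h, zero_mul, h3] at h1 h2
      change f x = 0
      linarith
    · rintro rfl
      refine le_antisymm (norm_le_of_sub_le _ le_rfl fun x y => ?_) (Lip0.norm_nonneg' _)
      change (0 : ℝ) - 0 ≤ _
      simp

instance : NormedAddCommGroup (Lip0 M p) := NormedAddCommGroup.ofCore core

instance : NormedSpace ℝ (Lip0 M p) := NormedSpace.ofCore core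

end Lip0

/-- The real Banach space `ℓ₁` of absolutely summable sequences. -/
abbrev EllOne : Type := lp (fun _ : ℕ => ℝ) 1

/-- The integer grid of `ℓ₁`: all finite integer combinations of the standard basis. -/
def gridEllOne : Set EllOne :=
  {x | ∃ (N : ℕ) (a : ℕ → ℤ), x = ∑ n ∈ Finset.range N, (a n : ℝ) • lp.single 1 n (1 : ℝ)}

theorem zero_mem_gridEllOne : (0 : EllOne) ∈ gridEllOne := ⟨0, 0, by simp⟩

end

/-!
Write `A` for the Lipschitz space of the integer grid, `B` for that of `ℓ₁`, and `ℓ∞(A)` for the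
space `ℕ →ᵇ A` of bounded sequences in `A`. By Pełczyński's decomposition method
(`nonempty_equiv_of_complemented`) it is enough that `ℓ∞(A)` is complemented in `A`, that `A` is
complemented in `B`, and that `B` is complemented in `ℓ∞(A)`.

* `A` is complemented in `B`: restriction to the grid has the linear right inverse
  `f ↦ (x ↦ ∫ u in (0, 1), f (⌊xₙ + u⌋)ₙ)`. It preserves Lipschitz constants because
  `∫ u in (0, 1), |⌊s + u⌋ - ⌊t + u⌋| = |s - t|` for all reals `s`, `t`, and this can be summed over
  the coordinates. See `EllOne.restrictGrid_extendGrid`.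
* `B` is complemented in `ℓ∞(A)`: send `f` to its rescaled restrictions to the grids of mesh
  `1 / (m + 1)`. Conversely, extend functions on these grids to `ℓ₁` and take the pointwise limit
  along a free ultrafilter; since the grids become dense, this recovers `f`. See
  `EllOne.limitExtend_scaledRestrictSeq`.
* `ℓ∞(A)` is complemented in `A`: split the coordinates into infinitely many infinite blocks. The
  grid points supported in the `k`-th block form a copy of the grid, and functions `g k` given on
  these copies are glued to `x ↦ ∑ₖ wₖ(x) g k (xₖ)`, where `xₖ` is the `k`-th block of `x` and
  `wₖ(x) = (2‖xₖ‖ - ‖x‖)⁺ / ‖xₖ‖`. At most one summand is nonzero at each `x`, and each summand is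
  Lipschitz because `‖xₖ‖ wₖ(x)` is and `|g k (xₖ)| ≤ ‖g k‖ ‖xₖ‖`. See
  `EllOne.restrictBlockSeq_gluing`.
-/

noncomputable section

open scoped BoundedContinuousFunction ENNReal Topology
open Filter MeasureTheory

/-! ### Operators into Lipschitz spaces -/

namespace Lip0

variable {M N : Type*} [MetricSpace M] [MetricSpace N] {p : M} {q : N}

theorem abs_sub_le (f : Lip0 M p) (x y : M) : |f x - f y| ≤ ‖f‖ * dist x y :=
  abs_sub_le_iff.2 ⟨f.sub_le_norm_mul x y, by rw [dist_comm]; exact f.sub_le_norm_mul y x⟩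

theorem abs_le (f : Lip0 M p) (x : M) : |f x| ≤ ‖f‖ * dist x p := by
  have h := f.abs_sub_le x p
  rwa [show f p = 0 from f.2.2, sub_zero] at h

@[ext]
theorem ext {f g : Lip0 M p} (h : ∀ x, f x = g x) : f = g := Subtype.ext (funext h)

/-- A linear family of functions whose Lipschitz constants are controlled by the norm of the
parameter is a bounded operator into the Lipschitz space. -/
def mkCLM {V : Type*} [NormedAddCommGroup V] [NormedSpace ℝ V] (F : V →ₗ[ℝ] (M → ℝ)) (C : ℝ)
    (hC : 0 ≤ C) (hF : ∀ v x y, |F v x - F v y| ≤ C * ‖v‖ * dist x y) (h0 : ∀ v, F v p = 0) :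
    V →L[ℝ] Lip0 M p :=
  LinearMap.mkContinuous
    { toFun := fun v => ⟨F v, ⟨⟨C * ‖v‖, by positivity⟩, LipschitzWith.of_dist_le_mul (hF v)⟩, h0 v⟩
      map_add' := fun v w => Subtype.ext (F.map_add v w)
      map_smul' := fun c v => Subtype.ext (F.map_smul c v) }
    C fun v => norm_le_of_sub_le _ (by positivity) fun x y => (le_abs_self _).trans (hF v x y)

theorem norm_mkCLM_apply_le {V : Type*} [NormedAddCommGroup V] [NormedSpace ℝ V]
    (F : V →ₗ[ℝ] (M → ℝ)) (C : ℝ) (hC : 0 ≤ C)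
    (hF : ∀ v x y, |F v x - F v y| ≤ C * ‖v‖ * dist x y) (h0 : ∀ v, F v p = 0) (v : V) :
    ‖mkCLM F C hC hF h0 v‖ ≤ C * ‖v‖ :=
  norm_le_of_sub_le _ (by positivity) fun x y => (le_abs_self _).trans (hF v x y)

/-- The composition operator `f ↦ c • (f ∘ h)` of a base point preserving map `h`. -/
def compCLM (c : ℝ) (h : M → N) (C : ℝ) (hC : 0 ≤ C)
    (hh : ∀ x y, |c| * dist (h x) (h y) ≤ C * dist x y) (h0 : h p = q) :
    Lip0 N q →L[ℝ] Lip0 M p :=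
  mkCLM
    { toFun := fun f x => c * f (h x)
      map_add' := fun f g => by ext x; exact mul_add c (f (h x)) (g (h x))
      map_smul' := fun a f => by ext x; exact mul_left_comm c a (f (h x)) }
    C hC
    (fun f x y => by
      change |c * f (h x) - c * f (h y)| ≤ _
      rw [← mul_sub, abs_mul]
      calc |c| * |f (h x) - f (h y)| ≤ |c| * (‖f‖ * dist (h x) (h y)) := by
            gcongr; exact f.abs_sub_le _ _
        _ = ‖f‖ * (|c| * dist (h x) (h y)) := by ring
        _ ≤ ‖f‖ * (C * dist x y) := mul_le_mul_of_nonneg_left (hh x y) (norm_nonneg f)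
        _ = C * ‖f‖ * dist x y := by ring)
    (fun f => by
      change c * f (h p) = 0
      rw [h0, show f q = 0 from f.2.2, mul_zero])

theorem norm_compCLM_le (c : ℝ) (h : M → N) (C : ℝ) (hC : 0 ≤ C)
    (hh : ∀ x y, |c| * dist (h x) (h y) ≤ C * dist x y) (h0 : h p = q) (f : Lip0 N q) :
    ‖compCLM (p := p) c h C hC hh h0 f‖ ≤ C * ‖f‖ :=
  norm_mkCLM_apply_le _ _ _ _ _ _

end Lip0

/-! ### Decomposition method for spaces of bounded sequences -/

/-- A uniformly bounded family of operators `T n : V → W` as a single operator into the space of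
bounded sequences of `W`. -/
def seqCLM {V W : Type*} [NormedAddCommGroup V] [NormedSpace ℝ V] [NormedAddCommGroup W]
    [NormedSpace ℝ W] (T : ℕ → V →L[ℝ] W) (C : ℝ) (hT : ∀ n v, ‖T n v‖ ≤ C * ‖v‖) :
    V →L[ℝ] (ℕ →ᵇ W) :=
  LinearMap.mkContinuous
    { toFun := fun v => BoundedContinuousFunction.ofNormedAddCommGroupDiscrete
        (fun n => T n v) (C * ‖v‖) (fun n => hT n v)
      map_add' := fun v w => by ext n; simp
      map_smul' := fun c v => by ext n; simp }
    C fun v => (BoundedContinuousFunction.norm_le ((norm_nonneg _).trans (hT 0 v))).2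
      fun n => hT n v

@[simp]
theorem seqCLM_apply {V W : Type*} [NormedAddCommGroup V] [NormedSpace ℝ V]
    [NormedAddCommGroup W] [NormedSpace ℝ W] (T : ℕ → V →L[ℝ] W) (C : ℝ)
    (hT : ∀ n v, ‖T n v‖ ≤ C * ‖v‖) (v : V) (n : ℕ) : seqCLM T C hT v n = T n v := rfl

/-- The operator `y ↦ y n` on bounded sequences. -/
def coordCLM (W : Type*) [NormedAddCommGroup W] [NormedSpace ℝ W] (n : ℕ) : (ℕ →ᵇ W) →L[ℝ] W :=
  BoundedContinuousFunction.evalCLM ℝ n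

@[simp]
theorem coordCLM_apply {W : Type*} [NormedAddCommGroup W] [NormedSpace ℝ W] (n : ℕ)
    (y : ℕ →ᵇ W) : coordCLM W n y = y n := rfl

section Decomposition

variable {X Y : Type*} [NormedAddCommGroup X] [NormedSpace ℝ X] [NormedAddCommGroup Y]
  [NormedSpace ℝ Y]

/-- If `X` is complemented in `Y` then `X × ℓ∞(Y) ≃ ℓ∞(Y)`: with `Y = X ⊕ V`, shift the
`X`-components of the sequence by one place. -/
def prodBddSeqEquiv (i : X →L[ℝ] Y) (r : Y →L[ℝ] X) (h : ∀ x, r (i x) = x) :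
    (X × (ℕ →ᵇ Y)) ≃L[ℝ] (ℕ →ᵇ Y) := by
  set P : Y →L[ℝ] Y := i.comp r with hP
  set Q : Y →L[ℝ] Y := ContinuousLinearMap.id ℝ Y - P with hQ
  let sy := ContinuousLinearMap.snd ℝ X (ℕ →ᵇ Y)
  let F : ℕ → (X × (ℕ →ᵇ Y)) →L[ℝ] Y := fun n =>
    Nat.casesOn n (i.comp (ContinuousLinearMap.fst ℝ X (ℕ →ᵇ Y)) + Q.comp ((coordCLM Y 0).comp sy))
      fun k => P.comp ((coordCLM Y k).comp sy) + Q.comp ((coordCLM Y (k + 1)).comp sy)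
  have hF : ∀ n v, ‖F n v‖ ≤ (‖i‖ + ‖P‖ + ‖Q‖) * ‖v‖ := by
    intro n v
    have h1 : ‖v.1‖ ≤ ‖v‖ := norm_fst_le v
    have h2 : ∀ k, ‖v.2 k‖ ≤ ‖v‖ := fun k => (v.2.norm_coe_le_norm k).trans (norm_snd_le v)
    cases n with
    | zero =>
      calc ‖i v.1 + Q (v.2 0)‖ ≤ ‖i‖ * ‖v‖ + ‖Q‖ * ‖v‖ :=
            norm_add_le_of_le (i.le_opNorm_of_le h1) (Q.le_opNorm_of_le (h2 0))
        _ ≤ _ := by nlinarith [mul_nonneg (norm_nonneg P) (norm_nonneg v)]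
    | succ k =>
      calc ‖P (v.2 k) + Q (v.2 (k + 1))‖ ≤ ‖P‖ * ‖v‖ + ‖Q‖ * ‖v‖ :=
            norm_add_le_of_le (P.le_opNorm_of_le (h2 k)) (Q.le_opNorm_of_le (h2 _))
        _ ≤ _ := by nlinarith [mul_nonneg (norm_nonneg i) (norm_nonneg v)]
  let G : ℕ → (ℕ →ᵇ Y) →L[ℝ] Y := fun n => P.comp (coordCLM Y (n + 1)) + Q.comp (coordCLM Y n)
  have hG : ∀ n v, ‖G n v‖ ≤ (‖P‖ + ‖Q‖) * ‖v‖ := by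
    intro n v
    rw [add_mul]
    exact norm_add_le_of_le (P.le_opNorm_of_le (v.norm_coe_le_norm _))
      (Q.le_opNorm_of_le (v.norm_coe_le_norm _))
  refine ContinuousLinearEquiv.equivOfInverse (seqCLM F _ hF)
    ((r.comp (coordCLM Y 0)).prod (seqCLM G _ hG)) ?_ ?_
  · rintro ⟨x, y⟩
    refine Prod.ext ?_ (BoundedContinuousFunction.ext fun n => ?_)
    · simp [F, hP, hQ, sy, h]
    · cases n <;> simp [F, G, hP, hQ, sy, h]
  · intro y
    refine BoundedContinuousFunction.ext fun n => ?_
    cases n <;> simp [F, G, hP, hQ, sy, h]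

/-- If `Y × Y ≃ Y` and `Y` is complemented in `X`, then `Y × X ≃ X`: with `X = Y ⊕ W`, absorb the
extra copy of `Y` into the summand `Y`. -/
def prodComplementedEquiv (σ : (Y × Y) ≃L[ℝ] Y) (j : Y →L[ℝ] X) (q : X →L[ℝ] Y)
    (h : ∀ y, q (j y) = y) : (Y × X) ≃L[ℝ] X := by
  let fs := ContinuousLinearMap.fst ℝ Y X
  let sn := ContinuousLinearMap.snd ℝ Y X
  let a := (ContinuousLinearMap.fst ℝ Y Y).comp ((σ.symm : Y →L[ℝ] Y × Y).comp q)
  let b := (ContinuousLinearMap.snd ℝ Y Y).comp ((σ.symm : Y →L[ℝ] Y × Y).comp q)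
  refine ContinuousLinearEquiv.equivOfInverse
    (sn - j.comp (q.comp sn) + j.comp ((σ : Y × Y →L[ℝ] Y).comp (fs.prod (q.comp sn))))
    (a.prod (ContinuousLinearMap.id ℝ X - j.comp q + j.comp b)) ?_ ?_
  · rintro ⟨y, x⟩
    refine Prod.ext ?_ ?_ <;> simp [fs, sn, a, b, h]
  · intro x
    simp [fs, sn, a, b, h]

/-- Interleaving two bounded sequences. -/
def bddSeqProdSelfEquiv (Y : Type*) [NormedAddCommGroup Y] [NormedSpace ℝ Y] :
    ((ℕ →ᵇ Y) × (ℕ →ᵇ Y)) ≃L[ℝ] (ℕ →ᵇ Y) := by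
  let e := Equiv.natSumNatEquivNat
  let fs := ContinuousLinearMap.fst ℝ (ℕ →ᵇ Y) (ℕ →ᵇ Y)
  let sn := ContinuousLinearMap.snd ℝ (ℕ →ᵇ Y) (ℕ →ᵇ Y)
  let D : ℕ ⊕ ℕ → ((ℕ →ᵇ Y) × (ℕ →ᵇ Y)) →L[ℝ] Y :=
    Sum.elim (fun n => (coordCLM Y n).comp fs) (fun n => (coordCLM Y n).comp sn)
  have hD : ∀ s v, ‖D s v‖ ≤ 1 * ‖v‖ := by
    rintro (n | n) v <;> rw [one_mul]
    · exact (v.1.norm_coe_le_norm n).trans (norm_fst_le v)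
    · exact (v.2.norm_coe_le_norm n).trans (norm_snd_le v)
  have hc : ∀ n (v : ℕ →ᵇ Y), ‖coordCLM Y n v‖ ≤ 1 * ‖v‖ := fun n v => by
    rw [one_mul]; exact v.norm_coe_le_norm n
  refine ContinuousLinearEquiv.equivOfInverse
    (seqCLM (fun n => D (e.symm n)) 1 fun n v => hD _ v)
    ((seqCLM (fun n => coordCLM Y (e (Sum.inl n))) 1 fun n v => hc _ v).prod
      (seqCLM (fun n => coordCLM Y (e (Sum.inr n))) 1 fun n v => hc _ v)) ?_ ?_
  · rintro ⟨y, z⟩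
    refine Prod.ext (BoundedContinuousFunction.ext fun n => ?_)
      (BoundedContinuousFunction.ext fun n => ?_) <;> simp [D, fs, sn]
  · intro y
    refine BoundedContinuousFunction.ext fun n => ?_
    obtain ⟨s, rfl⟩ := e.surjective n
    rcases s with n | n <;> simp [D, fs, sn]

/-- Pełczyński's decomposition method: if `ℓ∞(X)` is complemented in `X`, the space `X` is
complemented in `Y`, and `Y` is complemented in `ℓ∞(X)`, then `X ≃ Y`. -/
theorem nonempty_equiv_of_complemented
    (i₁ : (ℕ →ᵇ X) →L[ℝ] X) (r₁ : X →L[ℝ] (ℕ →ᵇ X)) (h₁ : ∀ y, r₁ (i₁ y) = y)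
    (i₂ : X →L[ℝ] Y) (r₂ : Y →L[ℝ] X) (h₂ : ∀ x, r₂ (i₂ x) = x)
    (i₃ : Y →L[ℝ] (ℕ →ᵇ X)) (r₃ : (ℕ →ᵇ X) →L[ℝ] Y) (h₃ : ∀ y, r₃ (i₃ y) = y) :
    Nonempty (X ≃L[ℝ] Y) := by
  -- `X ≃ ℓ∞(X) × X ≃ X × ℓ∞(X) ≃ ℓ∞(X)`
  let e : X ≃L[ℝ] (ℕ →ᵇ X) :=
    (prodComplementedEquiv (bddSeqProdSelfEquiv X) i₁ r₁ h₁).symm.trans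
      ((ContinuousLinearEquiv.prodComm ℝ _ _).trans
        (prodBddSeqEquiv (ContinuousLinearMap.id ℝ X) (ContinuousLinearMap.id ℝ X) fun _ => rfl))
  let σ : (X × X) ≃L[ℝ] X := (e.prodCongr e).trans ((bddSeqProdSelfEquiv X).trans e.symm)
  -- `X ≃ ℓ∞(X) ≃ Y × ℓ∞(X) ≃ Y × X ≃ X × Y ≃ Y`
  let s : (Y × (ℕ →ᵇ X)) ≃L[ℝ] (ℕ →ᵇ X) :=
    prodBddSeqEquiv ((e.symm : (ℕ →ᵇ X) →L[ℝ] X).comp i₃) (r₃.comp (e : X →L[ℝ] (ℕ →ᵇ X)))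
      (by simp [h₃])
  exact ⟨e.trans (s.symm.trans (((ContinuousLinearEquiv.refl ℝ Y).prodCongr e.symm).trans
    ((ContinuousLinearEquiv.prodComm ℝ _ _).trans (prodComplementedEquiv σ i₂ r₂ h₂))))⟩

end Decomposition

/-! ### The space `ℓ₁`, its grid and its blocks of coordinates -/

namespace EllOne

theorem summable_abs (x : EllOne) : Summable fun n => |x n| := by
  simpa using (lp.memℓp x).summable (by simp)

theorem norm_eq_tsum (x : EllOne) : ‖x‖ = ∑' n, |x n| := by
  simpa using lp.norm_eq_tsum_rpow (p := 1) (by simp) x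

theorem enorm_eq_tsum (x : EllOne) : ‖x‖ₑ = ∑' n, ‖x n‖ₑ := by
  rw [← ofReal_norm, norm_eq_tsum,
    ENNReal.ofReal_tsum_of_nonneg (fun _ => abs_nonneg _) x.summable_abs]
  simp only [← Real.norm_eq_abs, ofReal_norm]

/-- An absolutely summable sequence as an element of `ℓ₁`. -/
def ofSummable (a : ℕ → ℝ) (h : Summable fun n => |a n|) : EllOne :=
  ⟨a, (memℓp_gen_iff (by simp)).2 (by simpa using h)⟩

/-- Being null sequences, the integer valued elements of `ℓ₁` are finitely supported. -/
theorem mem_grid_iff (x : EllOne) : x ∈ gridEllOne ↔ ∀ n, ∃ a : ℤ, x n = a := by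
  constructor
  · rintro ⟨N, a, rfl⟩ n
    refine ⟨if n ∈ Finset.range N then a n else 0, ?_⟩
    rw [lp.coeFn_sum, Finset.sum_apply]
    simp [lp.single_apply, Pi.single_apply]
  · intro h
    choose a ha using h
    have h0 : Tendsto (fun n => |x n|) atTop (𝓝 0) := x.summable_abs.tendsto_atTop_zero
    obtain ⟨N, hN⟩ := eventually_atTop.1 (h0.eventually (gt_mem_nhds one_pos))
    refine ⟨N, a, ?_⟩
    ext n
    rw [lp.coeFn_sum, Finset.sum_apply]
    have h1 : n ∉ Finset.range N → a n = 0 := fun hn => by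
      have h2 := hN n (by simpa using hn)
      rw [ha n] at h2
      exact Int.abs_lt_one_iff.1 (by exact_mod_cast h2)
    by_cases hn : n ∈ Finset.range N
    · simp [lp.single_apply, Pi.single_apply, ha, Finset.mem_range.1 hn]
    · simp [lp.single_apply, Pi.single_apply, ha, h1 hn]

instance : Countable gridEllOne := by
  have : gridEllOne ⊆ Set.range fun a : ℕ →₀ ℤ =>
      ∑ n ∈ a.support, (a n : ℝ) • (lp.single 1 n (1 : ℝ) : EllOne) := by
    rintro _ ⟨N, a, rfl⟩
    refine ⟨Finsupp.onFinset (Finset.range N) (fun n => if n ∈ Finset.range N then a n else 0)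
      (fun n hn => by by_contra h; simp [h] at hn), ?_⟩
    refine (Finset.sum_subset (Finsupp.support_onFinset_subset) ?_).trans ?_
    · intro n _ hn
      rw [Finsupp.notMem_support_iff.1 hn]; simp
    · refine Finset.sum_congr rfl fun n hn => ?_
      rw [Finsupp.onFinset_apply, if_pos hn]
  exact ((Set.countable_range _).mono this).to_subtype

/-- Restriction of `x` to the coordinates in the `k`-th block `{pair k n | n}`, as a sequence
indexed by `n`. -/
def block (k : ℕ) (x : EllOne) : EllOne :=
  ofSummable (fun n => x (Nat.pair k n))
    (x.summable_abs.comp_injective (i := Nat.pair k) fun _ _ h => (Nat.pair_eq_pair.1 h).2)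

theorem block_apply (k : ℕ) (x : EllOne) (n : ℕ) : block k x n = x (Nat.pair k n) := rfl

theorem hasSum_norm_block (x : EllOne) : HasSum (fun k => ‖block k x‖) ‖x‖ := by
  have h : Summable fun q : ℕ × ℕ => |x (Nat.pair q.1 q.2)| :=
    (Nat.pairEquiv.summable_iff (f := fun n => |x n|)).2 x.summable_abs
  have h1 : ‖x‖ = ∑' q : ℕ × ℕ, |x (Nat.pair q.1 q.2)| := by
    rw [norm_eq_tsum]
    exact (Nat.pairEquiv.tsum_eq (fun n => |x n|)).symm
  have h2 : ∀ k, ‖block k x‖ = ∑' n, |x (Nat.pair k n)| := fun k => norm_eq_tsum _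
  rw [h1]
  simp only [h2]
  exact h.hasSum.prod_fiberwise fun k => (h.prod_factor k).hasSum

theorem norm_block_add_le {j k : ℕ} (hjk : j ≠ k) (x : EllOne) :
    ‖block j x‖ + ‖block k x‖ ≤ ‖x‖ := by
  have h := sum_le_hasSum {j, k} (fun i _ => norm_nonneg (block i x)) x.hasSum_norm_block
  rwa [Finset.sum_pair hjk] at h

theorem norm_block_le (k : ℕ) (x : EllOne) : ‖block k x‖ ≤ ‖x‖ :=
  le_hasSum x.hasSum_norm_block k fun _ _ => norm_nonneg _

theorem block_sub (k : ℕ) (x y : EllOne) : block k (x - y) = block k x - block k y := by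
  ext n; rfl

theorem block_mem_grid {x : EllOne} (hx : x ∈ gridEllOne) (k : ℕ) : block k x ∈ gridEllOne :=
  (mem_grid_iff _).2 fun n => (mem_grid_iff x).1 hx (Nat.pair k n)

theorem summable_blockEmbed (k : ℕ) (x : EllOne) :
    Summable fun m => |if (Nat.unpair m).1 = k then x (Nat.unpair m).2 else 0| := by
  have hi : Function.Injective (Nat.pair k) := fun _ _ h => (Nat.pair_eq_pair.1 h).2
  refine (hi.summable_iff fun m hm => ?_).1 ?_
  · rw [if_neg, abs_zero]
    rintro rfl
    exact hm ⟨_, Nat.pair_unpair m⟩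
  · simpa [Function.comp_def] using x.summable_abs

/-- The element of `ℓ₁` whose `k`-th block is `x` and whose other blocks vanish. -/
def blockEmbed (k : ℕ) (x : EllOne) : EllOne := ofSummable _ (summable_blockEmbed k x)

theorem blockEmbed_apply (k : ℕ) (x : EllOne) (m : ℕ) :
    blockEmbed k x m = if (Nat.unpair m).1 = k then x (Nat.unpair m).2 else 0 := rfl

theorem block_blockEmbed_self (k : ℕ) (x : EllOne) : block k (blockEmbed k x) = x := by
  ext n; simp [block_apply, blockEmbed_apply]

theorem block_blockEmbed_of_ne {j k : ℕ} (hjk : j ≠ k) (x : EllOne) :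
    block j (blockEmbed k x) = 0 := by
  ext n; simp [block_apply, blockEmbed_apply, hjk]

theorem norm_blockEmbed (k : ℕ) (x : EllOne) : ‖blockEmbed k x‖ = ‖x‖ := by
  have h := hasSum_single (f := fun j => ‖block j (blockEmbed k x)‖) k fun j hj => by
    rw [block_blockEmbed_of_ne hj, norm_zero]
  rw [(hasSum_norm_block _).unique h, block_blockEmbed_self]

theorem blockEmbed_sub (k : ℕ) (x y : EllOne) :
    blockEmbed k (x - y) = blockEmbed k x - blockEmbed k y := by
  ext n
  rw [lp.coeFn_sub, Pi.sub_apply]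
  simp only [blockEmbed_apply, lp.coeFn_sub, Pi.sub_apply]
  split_ifs <;> simp

theorem blockEmbed_mem_grid {x : EllOne} (hx : x ∈ gridEllOne) (k : ℕ) :
    blockEmbed k x ∈ gridEllOne := by
  refine (mem_grid_iff _).2 fun m => ?_
  rw [blockEmbed_apply]
  split_ifs
  · exact (mem_grid_iff x).1 hx _
  · exact ⟨0, by simp⟩

/-- The grids `m⁻¹ ℤ_{ℓ₁}` become dense as `m` grows. -/
theorem eventually_exists_grid_near (x : EllOne) {ε : ℝ} (hε : 0 < ε) :
    ∀ᶠ m : ℕ in atTop, ∃ z ∈ gridEllOne, ‖x - ((m : ℝ) + 1)⁻¹ • z‖ ≤ ε := by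
  have h := lp.hasSum_single (p := 1) (by simp) x
  obtain ⟨s, hs⟩ := (h.eventually (Metric.ball_mem_nhds x (half_pos hε))).exists
  have hlim : Tendsto (fun m : ℕ => (s.card : ℝ) * (1 / ((m : ℝ) + 1))) atTop (𝓝 0) := by
    simpa using tendsto_one_div_add_atTop_nhds_zero_nat.const_mul (s.card : ℝ)
  filter_upwards [hlim.eventually (gt_mem_nhds (half_pos hε))] with m hm
  have hm0 : (0 : ℝ) < m + 1 := by positivity
  refine ⟨∑ n ∈ s, lp.single 1 n (⌊((m : ℝ) + 1) * x n⌋ : ℝ), (mem_grid_iff _).2 fun n => ?_, ?_⟩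
  · refine ⟨if n ∈ s then ⌊((m : ℝ) + 1) * x n⌋ else 0, ?_⟩
    rw [lp.coeFn_sum, Finset.sum_apply]
    simp [lp.single_apply, Pi.single_apply]
  · have h1 : ‖∑ n ∈ s, (lp.single 1 n (x n) : EllOne) -
        ((m : ℝ) + 1)⁻¹ • ∑ n ∈ s, lp.single 1 n (⌊((m : ℝ) + 1) * x n⌋ : ℝ)‖ ≤ ε / 2 := by
      rw [Finset.smul_sum, ← Finset.sum_sub_distrib]
      refine ((norm_sum_le_of_le (f := fun n => _) (n := fun _ => 1 / ((m : ℝ) + 1)) s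
        fun n _ => ?_).trans_eq (Finset.sum_const _)).trans ?_
      · rw [← lp.single_smul, ← lp.single_sub, lp.norm_single one_pos, smul_eq_mul,
          Real.norm_eq_abs]
        have h2 : x n - ((m : ℝ) + 1)⁻¹ * ⌊((m : ℝ) + 1) * x n⌋
            = Int.fract (((m : ℝ) + 1) * x n) / (m + 1) := by
          rw [Int.fract]; field_simp
        rw [h2, abs_of_nonneg (div_nonneg (Int.fract_nonneg _) hm0.le)]
        gcongr
        exact (Int.fract_lt_one _).le
      · rw [nsmul_eq_mul]; exact hm.le
    rw [dist_eq_norm'] at hs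
    calc _ ≤ _ := norm_sub_le_norm_sub_add_norm_sub x (∑ n ∈ s, (lp.single 1 n (x n) : EllOne)) _
      _ ≤ ε / 2 + ε / 2 := add_le_add hs.le h1
      _ = ε := add_halves ε

end EllOne

/-! ### Extension from the grid by averaged rounding -/

attribute [local instance] Measure.Subtype.measureSpace

/-- The base point of the integer grid. -/
abbrev gridZero : gridEllOne := ⟨0, zero_mem_gridEllOne⟩

instance isProbabilityMeasure_Ioo_zero_one :
    IsProbabilityMeasure (volume : Measure (Set.Ioo (0 : ℝ) 1)) :=
  ⟨by rw [Measure.Subtype.volume_univ measurableSet_Ioo.nullMeasurableSet]; simp⟩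

theorem integrable_floor_add (t : ℝ) :
    Integrable fun u : Set.Ioo (0 : ℝ) 1 => (⌊t + u⌋ : ℝ) := by
  refine Integrable.of_bound (C := |t| + 2) ?_ (Eventually.of_forall fun u => ?_)
  · exact (measurable_from_top.comp
      (Int.measurable_floor.comp (measurable_subtype_coe.const_add t))).aestronglyMeasurable
  · have h1 := Int.floor_le (t + u)
    have h2 := Int.lt_floor_add_one (t + u)
    have h3 := u.2.1
    have h4 := u.2.2
    rw [Real.norm_eq_abs, abs_le]
    constructor <;> linarith [neg_abs_le t, le_abs_self t]

/-- Rounding with a uniform shift is unbiased: `⌊y⌋ = y - fract y`, and the integral of the periodic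
function `fract` over any interval of length `1` is `1 / 2`. -/
theorem integral_floor_add (t : ℝ) : ∫ u : Set.Ioo (0 : ℝ) 1, (⌊t + u⌋ : ℝ) = t := by
  have hp : Function.Periodic (Int.fract : ℝ → ℝ) 1 := fun x => Int.fract_add_one x
  have h1 : ∫ u in (0 : ℝ)..1, Int.fract (t + u) = 1 / 2 := by
    rw [intervalIntegral.integral_comp_add_left (fun u => Int.fract u) t, add_zero,
      hp.intervalIntegral_add_eq t 0, zero_add, intervalIntegral.integral_of_le zero_le_one,
      integral_Ioc_eq_integral_Ioo,
      setIntegral_congr_fun (g := fun u => u) measurableSet_Ioo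
        fun u hu => Int.fract_eq_self.2 ⟨hu.1.le, hu.2⟩,
      ← integral_Ioc_eq_integral_Ioo, ← intervalIntegral.integral_of_le zero_le_one, integral_id]
    norm_num
  have h2 : ∫ u in (0 : ℝ)..1, (t + u) = t + 1 / 2 := by
    rw [intervalIntegral.integral_add (by simp) (by simp), integral_id]
    simp
  have hi : IntervalIntegrable (fun u => Int.fract (t + u)) volume 0 1 := by
    rw [intervalIntegrable_iff_integrableOn_Ioc_of_le zero_le_one]
    refine Measure.integrableOn_of_bounded (M := 1) (by simp)
      (measurable_fract.comp (measurable_const_add t)).aestronglyMeasurable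
      (Eventually.of_forall fun u => ?_)
    rw [Real.norm_eq_abs, abs_of_nonneg (Int.fract_nonneg _)]
    exact (Int.fract_lt_one _).le
  rw [integral_subtype measurableSet_Ioo fun u : ℝ => (⌊t + u⌋ : ℝ),
    ← integral_Ioc_eq_integral_Ioo, ← intervalIntegral.integral_of_le zero_le_one]
  calc ∫ u in (0 : ℝ)..1, (⌊t + u⌋ : ℝ) = ∫ u in (0 : ℝ)..1, ((t + u) - Int.fract (t + u)) := by
        simp only [Int.self_sub_fract]
    _ = t := by
        rw [intervalIntegral.integral_sub ((continuous_const_add t).intervalIntegrable 0 1) hi, h1, h2]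
        ring

/-- Rounding with a common uniform shift is an isometry on average. -/
theorem lintegral_enorm_floor_sub (s t : ℝ) :
    ∫⁻ u : Set.Ioo (0 : ℝ) 1, ‖(⌊s + u⌋ : ℝ) - ⌊t + u⌋‖ₑ = ‖s - t‖ₑ := by
  wlog hst : t ≤ s generalizing s t
  · rw [enorm_sub_rev s t, ← this t s (not_le.1 hst).le]
    simp only [enorm_sub_rev]
  refine (ofReal_integral_norm_eq_lintegral_enorm
    ((integrable_floor_add s).sub (integrable_floor_add t))).symm.trans ?_
  rw [← ofReal_norm, Real.norm_of_nonneg (sub_nonneg.2 hst)]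
  congr 1
  calc _ = ∫ u : Set.Ioo (0 : ℝ) 1, ((⌊s + u⌋ : ℝ) - ⌊t + u⌋) := by
        refine integral_congr_ae (Eventually.of_forall fun u => Real.norm_of_nonneg ?_)
        exact sub_nonneg.2 (Int.cast_le.2 (Int.floor_le_floor (add_le_add_left hst _)))
    _ = s - t := by
        rw [integral_sub (integrable_floor_add s) (integrable_floor_add t), integral_floor_add,
          integral_floor_add]

namespace EllOne

/-- For `0 < u < 1`, the shifted rounding of a null sequence is finitely supported. -/
theorem summable_floor_add (u : Set.Ioo (0 : ℝ) 1) (x : EllOne) :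
    Summable fun n => |(⌊x n + u⌋ : ℝ)| := by
  have h0 : Tendsto (fun n => |x n|) cofinite (𝓝 0) := x.summable_abs.tendsto_cofinite_zero
  have hu : 0 < min (u : ℝ) (1 - u) := lt_min u.2.1 (sub_pos.2 u.2.2)
  refine summable_of_hasFiniteSupport ((h0.eventually (gt_mem_nhds hu)).mono fun n hn => ?_)
  obtain ⟨h1, h2⟩ := lt_min_iff.1 hn
  rw [abs_lt] at h1 h2
  have : ⌊x n + u⌋ = 0 := Int.floor_eq_zero_iff.2 ⟨by linarith, by linarith⟩
  simp [this]

/-- The grid point obtained by rounding each `x n` to `⌊x n + u⌋`, with the same shift `u` for all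
coordinates; independent shifts are not needed, as only the sum of the coordinatewise mean distances
matters. -/
def roundShift (u : Set.Ioo (0 : ℝ) 1) (x : EllOne) : gridEllOne :=
  ⟨ofSummable _ (summable_floor_add u x), (mem_grid_iff _).2 fun n => ⟨⌊x n + u⌋, rfl⟩⟩

theorem roundShift_apply (u : Set.Ioo (0 : ℝ) 1) (x : EllOne) (n : ℕ) :
    (roundShift u x : EllOne) n = ⌊x n + u⌋ := rfl

theorem roundShift_of_mem (u : Set.Ioo (0 : ℝ) 1) (x : gridEllOne) : roundShift u x = x := by
  ext n
  obtain ⟨a, ha⟩ := (mem_grid_iff _).1 x.2 n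
  rw [roundShift_apply, ha, Int.floor_intCast_add, Int.floor_eq_zero_iff.2 ⟨u.2.1.le, u.2.2⟩,
    add_zero]

theorem measurable_comp_roundShift (f : gridEllOne → ℝ) (x : EllOne) :
    Measurable fun u => f (roundShift u x) := by
  let _ : MeasurableSpace gridEllOne := ⊤
  refine (measurable_from_top (f := f)).comp (measurable_to_countable' fun g => ?_)
  have : (fun u => roundShift u x) ⁻¹' {g} =
      ⋂ n, {u : Set.Ioo (0 : ℝ) 1 | (⌊x n + u⌋ : ℝ) = (g : EllOne) n} := by
    ext u
    rw [Set.mem_preimage, Set.mem_singleton_iff, Set.mem_iInter, Subtype.ext_iff]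
    exact (lp.ext_iff (f := (roundShift u x : EllOne))).trans funext_iff
  rw [this]
  refine MeasurableSet.iInter fun n => ?_
  exact measurableSet_eq_fun (measurable_from_top.comp
    (Int.measurable_floor.comp (measurable_subtype_coe.const_add (x n)))) measurable_const

theorem lintegral_enorm_roundShift_sub (x y : EllOne) :
    ∫⁻ u, ‖(roundShift u x : EllOne) - roundShift u y‖ₑ = ‖x - y‖ₑ := by
  simp only [enorm_eq_tsum, lp.coeFn_sub, Pi.sub_apply, roundShift_apply]
  rw [lintegral_tsum fun n => ?_]
  · simp only [lintegral_enorm_floor_sub]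
  · exact ((integrable_floor_add (x n)).sub (integrable_floor_add (y n))).1.enorm

theorem lintegral_enorm_comp_roundShift_sub_le (f : Lip0 gridEllOne gridZero) (x y : EllOne) :
    ∫⁻ u, ‖f (roundShift u x) - f (roundShift u y)‖ₑ ≤ ‖f‖ₑ * ‖x - y‖ₑ := by
  rw [← lintegral_enorm_roundShift_sub, ← lintegral_const_mul' _ _ enorm_ne_top]
  refine lintegral_mono fun u => ?_
  rw [← enorm_norm f, ← ofReal_norm, ← ofReal_norm, ← ofReal_norm,
    ← ENNReal.ofReal_mul (norm_nonneg _), norm_norm]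
  refine ENNReal.ofReal_le_ofReal ((f.abs_sub_le _ _).trans_eq ?_)
  rw [Subtype.dist_eq, dist_eq_norm]

theorem integrable_comp_roundShift (f : Lip0 gridEllOne gridZero) (x : EllOne) :
    Integrable fun u => f (roundShift u x) := by
  refine ⟨(measurable_comp_roundShift f x).aestronglyMeasurable, ?_⟩
  have h := lintegral_enorm_comp_roundShift_sub_le f x 0
  have h0 : ∀ u, roundShift u 0 = gridZero := fun u => roundShift_of_mem u gridZero
  simp only [h0, show f gridZero = 0 from f.2.2, sub_zero] at h
  exact h.trans_lt (ENNReal.mul_lt_top enorm_lt_top enorm_lt_top)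

/-- The linear extension operator from the grid to `ℓ₁`: average over all shifted roundings. -/
def extendGrid : Lip0 gridEllOne gridZero →L[ℝ] Lip0 EllOne 0 :=
  Lip0.mkCLM
    { toFun := fun f x => ∫ u, f (roundShift u x)
      map_add' := fun f g => by
        ext x
        exact integral_add (integrable_comp_roundShift f x) (integrable_comp_roundShift g x)
      map_smul' := fun c f => by
        ext x
        exact integral_const_mul c fun u => f (roundShift u x) }
    1 zero_le_one
    (fun f x y => by
      change |(∫ u, f (roundShift u x)) - ∫ u, f (roundShift u y)| ≤ _
      rw [← integral_sub (integrable_comp_roundShift f x) (integrable_comp_roundShift f y),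
        one_mul, dist_eq_norm, ← Real.norm_eq_abs,
        ← ENNReal.ofReal_le_ofReal_iff (by positivity), ENNReal.ofReal_mul (norm_nonneg _)]
      simp only [ofReal_norm]
      exact (enorm_integral_le_lintegral_enorm _).trans
        (lintegral_enorm_comp_roundShift_sub_le f x y))
    (fun f => by
      change ∫ u, f (roundShift u 0) = 0
      have h0 : ∀ u, roundShift u 0 = gridZero := fun u => roundShift_of_mem u gridZero
      simp only [h0, show f gridZero = 0 from f.2.2, integral_zero])

theorem extendGrid_apply (f : Lip0 gridEllOne gridZero) (x : EllOne) :
    extendGrid f x = ∫ u, f (roundShift u x) := rfl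

theorem extendGrid_coe (f : Lip0 gridEllOne gridZero) (x : gridEllOne) :
    extendGrid f x = f x := by
  simp only [extendGrid_apply, roundShift_of_mem, integral_const, probReal_univ, one_smul]

theorem norm_extendGrid_le (f : Lip0 gridEllOne gridZero) : ‖extendGrid f‖ ≤ ‖f‖ :=
  (Lip0.norm_mkCLM_apply_le _ _ _ _ _ f).trans_eq (one_mul _)

/-- Restriction from `ℓ₁` to the grid. -/
def restrictGrid : Lip0 EllOne 0 →L[ℝ] Lip0 gridEllOne gridZero :=
  Lip0.compCLM 1 (fun x => (x : EllOne)) 1 zero_le_one (fun x y => by simp [Subtype.dist_eq]) rfl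

theorem restrictGrid_apply (f : Lip0 EllOne 0) (x : gridEllOne) : restrictGrid f x = f x :=
  one_mul _

theorem restrictGrid_extendGrid (f : Lip0 gridEllOne gridZero) :
    restrictGrid (extendGrid f) = f :=
  Lip0.ext fun x => by rw [restrictGrid_apply, extendGrid_coe]

end EllOne

/-! ### Weak-star limits -/

namespace Lip0

variable {M : Type*} [MetricSpace M] {p : M}

theorem exists_tendsto_hyperfilter (g : ℕ →ᵇ Lip0 M p) (x : M) :
    ∃ a, Tendsto (fun n => g n x) (hyperfilter ℕ : Filter ℕ) (𝓝 a) := by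
  have h : ∀ n, g n x ∈ Metric.closedBall (0 : ℝ) (‖g‖ * dist x p) := fun n => by
    rw [mem_closedBall_zero_iff]
    exact ((g n).abs_le x).trans (by gcongr; exact g.norm_coe_le_norm n)
  obtain ⟨a, -, ha⟩ := (isCompact_closedBall (0 : ℝ) (‖g‖ * dist x p)).ultrafilter_le_nhds
    ((hyperfilter ℕ).map fun n => g n x)
    (le_principal_iff.2 (mem_map.2 (univ_mem' h)))
  exact ⟨a, ha⟩

/-- The pointwise limit of `g n x` along a fixed free ultrafilter on `ℕ`. -/
def ultralimitFun (g : ℕ →ᵇ Lip0 M p) (x : M) : ℝ := (exists_tendsto_hyperfilter g x).choose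

theorem tendsto_ultralimitFun (g : ℕ →ᵇ Lip0 M p) (x : M) :
    Tendsto (fun n => g n x) (hyperfilter ℕ : Filter ℕ) (𝓝 (ultralimitFun g x)) :=
  (exists_tendsto_hyperfilter g x).choose_spec

/-- The weak-star limit of a bounded sequence in `Lip₀(M)` along a free ultrafilter, as a bounded
operator. -/
def ultralimit : (ℕ →ᵇ Lip0 M p) →L[ℝ] Lip0 M p :=
  mkCLM
    { toFun := ultralimitFun
      map_add' := fun g h => by
        ext x
        exact tendsto_nhds_unique (tendsto_ultralimitFun (g + h) x)
          ((tendsto_ultralimitFun g x).add (tendsto_ultralimitFun h x))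
      map_smul' := fun c g => by
        ext x
        exact tendsto_nhds_unique (tendsto_ultralimitFun (c • g) x)
          ((tendsto_ultralimitFun g x).const_mul c) }
    1 zero_le_one
    (fun g x y => by
      rw [one_mul]
      refine le_of_tendsto ((tendsto_ultralimitFun g x).sub (tendsto_ultralimitFun g y)).abs
        (Eventually.of_forall fun n => ((g n).abs_sub_le x y).trans ?_)
      gcongr
      exact g.norm_coe_le_norm n)
    (fun g => tendsto_nhds_unique (tendsto_ultralimitFun g p) (by
      have h : ∀ n, g n p = 0 := fun n => (g n).2.2
      simp only [h]
      exact tendsto_const_nhds))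

theorem ultralimit_apply_of_tendsto (g : ℕ →ᵇ Lip0 M p) {x : M} {a : ℝ}
    (h : Tendsto (fun n => g n x) atTop (𝓝 a)) : ultralimit g x = a :=
  tendsto_nhds_unique (tendsto_ultralimitFun g x)
    (h.mono_left (Nat.cofinite_eq_atTop ▸ hyperfilter_le_cofinite))

end Lip0

/-! ### `Lip₀(ℓ₁)` as a complemented subspace of bounded sequences on the grid -/

namespace EllOne

/-- Rescaled restriction `f ↦ (z ↦ (m + 1) f (z / (m + 1)))` to the grid of mesh `1 / (m + 1)`. -/
def scaledRestrict (m : ℕ) : Lip0 EllOne 0 →L[ℝ] Lip0 gridEllOne gridZero :=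
  Lip0.compCLM ((m : ℝ) + 1) (fun z => ((m : ℝ) + 1)⁻¹ • (z : EllOne)) 1 zero_le_one
    (fun x y => by
      have hm : (0 : ℝ) < m + 1 := by positivity
      rw [dist_smul₀, Real.norm_eq_abs, ← mul_assoc, ← abs_mul, mul_inv_cancel₀ hm.ne', abs_one,
        Subtype.dist_eq])
    (smul_zero _)

theorem scaledRestrict_apply (m : ℕ) (f : Lip0 EllOne 0) (z : gridEllOne) :
    scaledRestrict m f z = ((m : ℝ) + 1) * f (((m : ℝ) + 1)⁻¹ • (z : EllOne)) := rfl

/-- The dilation `f ↦ (x ↦ f ((m + 1) x) / (m + 1))`. -/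
def dilate (m : ℕ) : Lip0 EllOne 0 →L[ℝ] Lip0 EllOne 0 :=
  Lip0.compCLM ((m : ℝ) + 1)⁻¹ (fun x => ((m : ℝ) + 1) • x) 1 zero_le_one
    (fun x y => by
      have hm : (0 : ℝ) < m + 1 := by positivity
      rw [dist_smul₀, Real.norm_eq_abs, ← mul_assoc, ← abs_mul, inv_mul_cancel₀ hm.ne', abs_one])
    (smul_zero _)

theorem dilate_apply (m : ℕ) (f : Lip0 EllOne 0) (x : EllOne) :
    dilate m f x = ((m : ℝ) + 1)⁻¹ * f (((m : ℝ) + 1) • x) := rfl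

/-- The rescaled restrictions of a function to finer and finer grids. -/
def scaledRestrictSeq : Lip0 EllOne 0 →L[ℝ] (ℕ →ᵇ Lip0 gridEllOne gridZero) :=
  seqCLM scaledRestrict 1 fun _ f => Lip0.norm_compCLM_le _ _ _ _ _ _ f

theorem norm_dilate_extendGrid_le (m : ℕ) (g : Lip0 gridEllOne gridZero) :
    ‖dilate m (extendGrid g)‖ ≤ ‖g‖ :=
  (Lip0.norm_compCLM_le _ _ _ _ _ _ _).trans ((one_mul _).trans_le (norm_extendGrid_le g))

/-- Extend functions on finer and finer grids to `ℓ₁` and pass to the limit. -/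
def limitExtend : (ℕ →ᵇ Lip0 gridEllOne gridZero) →L[ℝ] Lip0 EllOne 0 :=
  Lip0.ultralimit.comp
    (seqCLM (fun m => (dilate m).comp (extendGrid.comp (coordCLM _ m))) 1 fun m g =>
      (norm_dilate_extendGrid_le m (g m)).trans
        ((g.norm_coe_le_norm m).trans_eq (one_mul _).symm))

theorem limitExtend_scaledRestrictSeq (f : Lip0 EllOne 0) :
    limitExtend (scaledRestrictSeq f) = f := by
  refine Lip0.ext fun x => Lip0.ultralimit_apply_of_tendsto _ ?_
  change Tendsto (fun m => dilate m (extendGrid (scaledRestrict m f)) x) atTop (𝓝 (f x))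
  refine Metric.tendsto_nhds.2 fun ε hε => ?_
  have hδ : 0 < ε / (2 * ‖f‖ + 1) := by positivity
  filter_upwards [eventually_exists_grid_near x hδ] with m ⟨z, hz, hxz⟩
  have hm : (0 : ℝ) < m + 1 := by positivity
  set F := dilate m (extendGrid (scaledRestrict m f))
  have hF : ‖F‖ ≤ ‖f‖ := (norm_dilate_extendGrid_le m _).trans
    ((Lip0.norm_compCLM_le _ _ _ _ _ _ f).trans_eq (one_mul _))
  -- the two functions agree on the grid of mesh `1 / (m + 1)`
  have hFz : F (((m : ℝ) + 1)⁻¹ • z) = f (((m : ℝ) + 1)⁻¹ • z) := by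
    have h := extendGrid_coe (scaledRestrict m f) ⟨z, hz⟩
    rw [dilate_apply, smul_inv_smul₀ hm.ne']
    rw [scaledRestrict_apply] at h
    rw [h, inv_mul_cancel_left₀ hm.ne']
  rw [← dist_eq_norm] at hxz
  have h1 := F.abs_sub_le x (((m : ℝ) + 1)⁻¹ • z)
  have h2 := f.abs_sub_le x (((m : ℝ) + 1)⁻¹ • z)
  rw [hFz] at h1
  have h3 : dist (F x) (f x) ≤ 2 * ‖f‖ * (ε / (2 * ‖f‖ + 1)) := by
    rw [Real.dist_eq]
    calc |F x - f x| ≤ ‖F‖ * dist x (((m : ℝ) + 1)⁻¹ • z)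
          + ‖f‖ * dist x (((m : ℝ) + 1)⁻¹ • z) := by
          rw [abs_le] at h1 h2 ⊢
          constructor <;> linarith [h1.1, h1.2, h2.1, h2.2]
      _ ≤ ‖f‖ * (ε / (2 * ‖f‖ + 1)) + ‖f‖ * (ε / (2 * ‖f‖ + 1)) := by gcongr
      _ = _ := by ring
  refine h3.trans_lt ?_
  rw [mul_div_assoc', div_lt_iff₀ (by positivity)]
  nlinarith [norm_nonneg f]

/-! ### Gluing functions on blocks of coordinates -/

/-- A weight that equals `1` on vectors supported in the `k`-th block and vanishes unless the
`k`-th block carries more than half of the norm. It is `0`, by the convention for division by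
zero, where the `k`-th block vanishes. -/
def weight (k : ℕ) (x : EllOne) : ℝ := max (2 * ‖block k x‖ - ‖x‖) 0 / ‖block k x‖

theorem weight_nonneg (k : ℕ) (x : EllOne) : 0 ≤ weight k x :=
  div_nonneg (le_max_right _ _) (norm_nonneg _)

theorem weight_le_one (k : ℕ) (x : EllOne) : weight k x ≤ 1 :=
  div_le_one_of_le₀ (max_le (by linarith [norm_block_le k x]) (norm_nonneg _)) (norm_nonneg _)

theorem norm_block_mul_weight (k : ℕ) (x : EllOne) :
    ‖block k x‖ * weight k x = max (2 * ‖block k x‖ - ‖x‖) 0 := by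
  rcases eq_or_ne ‖block k x‖ 0 with h | h
  · rw [h, zero_mul, max_eq_right (by linarith [norm_nonneg x])]
  · rw [weight, mul_div_cancel₀ _ h]

theorem weight_eq_zero_of_le {k : ℕ} {x : EllOne} (h : 2 * ‖block k x‖ ≤ ‖x‖) :
    weight k x = 0 := by
  rw [weight, max_eq_right (by linarith), zero_div]

theorem exists_forall_weight_eq_zero (x : EllOne) : ∃ k, ∀ j ≠ k, weight j x = 0 := by
  by_cases h : ∃ k, ‖x‖ < 2 * ‖block k x‖
  · obtain ⟨k, hk⟩ := h
    exact ⟨k, fun j hj => weight_eq_zero_of_le (by linarith [norm_block_add_le hj x])⟩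
  · exact ⟨0, fun j _ => weight_eq_zero_of_le (not_lt.1 fun hj => h ⟨j, hj⟩)⟩

theorem weight_blockEmbed_self (k : ℕ) {x : EllOne} (hx : x ≠ 0) :
    weight k (blockEmbed k x) = 1 := by
  have h := norm_pos_iff.2 hx
  rw [weight, block_blockEmbed_self, norm_blockEmbed, max_eq_left (by linarith), two_mul,
    add_sub_cancel_right, div_self h.ne']

/-- `weight k` is not Lipschitz near `0`, but its product with the norm of the block is. -/
theorem norm_block_mul_abs_weight_sub_le (k : ℕ) (x y : EllOne) :
    ‖block k y‖ * |weight k x - weight k y| ≤ 4 * ‖x - y‖ := by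
  have h1 : |‖block k x‖ - ‖block k y‖| ≤ ‖x - y‖ :=
    (abs_norm_sub_norm_le _ _).trans (by rw [← block_sub]; exact norm_block_le k _)
  have h2 := abs_norm_sub_norm_le x y
  have h3 : |max (2 * ‖block k x‖ - ‖x‖) 0 - max (2 * ‖block k y‖ - ‖y‖) 0| ≤ 3 * ‖x - y‖ := by
    refine (abs_max_sub_max_le_abs _ _ _).trans ?_
    rw [abs_le] at h1 h2 ⊢
    constructor <;> linarith [h1.1, h1.2, h2.1, h2.2]
  rw [← norm_block_mul_weight, ← norm_block_mul_weight] at h3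
  have h4 : |(‖block k x‖ - ‖block k y‖) * weight k x| ≤ ‖x - y‖ := by
    rw [abs_mul, abs_of_nonneg (weight_nonneg k x)]
    exact (mul_le_of_le_one_right (abs_nonneg _) (weight_le_one k x)).trans h1
  calc ‖block k y‖ * |weight k x - weight k y|
      = |(‖block k x‖ * weight k x - ‖block k y‖ * weight k y)
          - (‖block k x‖ - ‖block k y‖) * weight k x| := by
        rw [← abs_of_nonneg (norm_nonneg (block k y)), ← abs_mul, abs_of_nonneg (norm_nonneg _)]
        congr 1; ring
    _ ≤ 3 * ‖x - y‖ + ‖x - y‖ := (abs_sub _ _).trans (add_le_add h3 h4)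
    _ = 4 * ‖x - y‖ := by ring

/-- The `k`-th block of a grid point, as a grid point. -/
def gridBlock (k : ℕ) (x : gridEllOne) : gridEllOne := ⟨block k x, block_mem_grid x.2 k⟩

/-- The grid point with `k`-th block `x` and vanishing other blocks. -/
def gridEmbed (k : ℕ) (x : gridEllOne) : gridEllOne := ⟨blockEmbed k x, blockEmbed_mem_grid x.2 k⟩

theorem abs_weight_mul_sub_le (f : Lip0 gridEllOne gridZero) (k : ℕ) (x y : gridEllOne) :
    |weight k x * f (gridBlock k x) - weight k y * f (gridBlock k y)| ≤ 5 * ‖f‖ * dist x y := by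
  have hd : dist x y = ‖(x : EllOne) - y‖ := by rw [Subtype.dist_eq, dist_eq_norm]
  have h1 : |f (gridBlock k x) - f (gridBlock k y)| ≤ ‖f‖ * dist x y := by
    refine (f.abs_sub_le _ _).trans ?_
    rw [hd, Subtype.dist_eq, dist_eq_norm]
    change ‖f‖ * ‖block k x - block k y‖ ≤ _
    rw [← block_sub]
    gcongr
    exact norm_block_le k _
  have h2 : |f (gridBlock k y)| ≤ ‖f‖ * ‖block k y‖ := by
    refine (f.abs_le _).trans_eq ?_
    rw [Subtype.dist_eq]
    exact congrArg _ (dist_zero_right _)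
  calc |weight k x * f (gridBlock k x) - weight k y * f (gridBlock k y)|
      = |weight k x * (f (gridBlock k x) - f (gridBlock k y))
          + f (gridBlock k y) * (weight k x - weight k y)| := by congr 1; ring
    _ ≤ weight k x * |f (gridBlock k x) - f (gridBlock k y)|
          + |f (gridBlock k y)| * |weight k x - weight k y| := by
        refine (abs_add_le _ _).trans_eq ?_
        rw [abs_mul, abs_mul, abs_of_nonneg (weight_nonneg k x)]
    _ ≤ 1 * (‖f‖ * dist x y) + ‖f‖ * ‖block k y‖ * |weight k x - weight k y| := by
        gcongr
        exact weight_le_one k x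
    _ ≤ 1 * (‖f‖ * dist x y) + ‖f‖ * (4 * dist x y) := by
        rw [mul_assoc, hd]
        exact add_le_add_right (mul_le_mul_of_nonneg_left
          (norm_block_mul_abs_weight_sub_le k x y) (norm_nonneg f)) _
    _ = 5 * ‖f‖ * dist x y := by ring

theorem exists_gluing_term_eq_zero (x : gridEllOne) :
    ∃ k, ∀ g : ℕ →ᵇ Lip0 gridEllOne gridZero, ∀ j ≠ k, weight j x * g j (gridBlock j x) = 0 := by
  obtain ⟨k, hk⟩ := exists_forall_weight_eq_zero x
  exact ⟨k, fun g j hj => by rw [hk j hj, zero_mul]⟩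

theorem summable_gluing (g : ℕ →ᵇ Lip0 gridEllOne gridZero) (x : gridEllOne) :
    Summable fun k => weight k x * g k (gridBlock k x) := by
  obtain ⟨k, hk⟩ := exists_gluing_term_eq_zero x
  exact (hasSum_single k (hk g)).summable

theorem abs_gluing_sub_le (g : ℕ →ᵇ Lip0 gridEllOne gridZero) (x y : gridEllOne) :
    |∑' k, weight k x * g k (gridBlock k x) - ∑' k, weight k y * g k (gridBlock k y)|
      ≤ 10 * ‖g‖ * dist x y := by
  obtain ⟨j, hj⟩ := exists_gluing_term_eq_zero x
  obtain ⟨k, hk⟩ := exists_gluing_term_eq_zero y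
  have h : ∀ i, |weight i x * g i (gridBlock i x) - weight i y * g i (gridBlock i y)|
      ≤ 5 * ‖g‖ * dist x y := fun i =>
    (abs_weight_mul_sub_le (g i) i x y).trans (by gcongr; exact g.norm_coe_le_norm i)
  have h0 : 0 ≤ ‖g‖ * dist x y := by positivity
  rw [← (summable_gluing g x).tsum_sub (summable_gluing g y)]
  -- only the dominating blocks of `x` and of `y` contribute
  rw [tsum_eq_sum (s := {j, k}) fun i hi => by
    rw [Finset.mem_insert, Finset.mem_singleton, not_or] at hi
    rw [hj g i hi.1, hk g i hi.2, sub_zero]]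
  refine (Finset.abs_sum_le_sum_abs _ _).trans ((Finset.sum_le_card_nsmul _ _ _ fun i _ => h i).trans
    ?_)
  rw [nsmul_eq_mul]
  have h2 : ((({j, k} : Finset ℕ).card : ℕ) : ℝ) ≤ 2 := by exact_mod_cast Finset.card_le_two
  calc _ ≤ 2 * (5 * ‖g‖ * dist x y) := by gcongr
    _ = _ := by ring

/-- Glue functions prescribed on the pairwise disjoint blocks to a function on the whole grid. -/
def gluing : (ℕ →ᵇ Lip0 gridEllOne gridZero) →L[ℝ] Lip0 gridEllOne gridZero :=
  Lip0.mkCLM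
    { toFun := fun g x => ∑' k, weight k x * g k (gridBlock k x)
      map_add' := fun g h => by
        ext x
        rw [Pi.add_apply, ← (summable_gluing g x).tsum_add (summable_gluing h x)]
        exact tsum_congr fun k => mul_add _ (g k (gridBlock k x)) (h k (gridBlock k x))
      map_smul' := fun c g => by
        ext x
        rw [Pi.smul_apply, smul_eq_mul, RingHom.id_apply, ← tsum_mul_left]
        exact tsum_congr fun k => mul_left_comm _ c (g k (gridBlock k x)) }
    10 (by norm_num) abs_gluing_sub_le
    (fun g => by
      refine (tsum_congr fun k => ?_).trans tsum_zero
      have h : block k 0 = 0 := by ext n; rfl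
      rw [weight_eq_zero_of_le (by simp [h]), zero_mul])

theorem gluing_apply (g : ℕ →ᵇ Lip0 gridEllOne gridZero) (x : gridEllOne) :
    gluing g x = ∑' k, weight k x * g k (gridBlock k x) := rfl

/-- The restriction of a function to the sub-grid of points supported in the `k`-th block. -/
def restrictBlock (k : ℕ) : Lip0 gridEllOne gridZero →L[ℝ] Lip0 gridEllOne gridZero :=
  Lip0.compCLM 1 (gridEmbed k) 1 zero_le_one
    (fun x y => by
      rw [abs_one, one_mul, one_mul, Subtype.dist_eq, Subtype.dist_eq, dist_eq_norm, dist_eq_norm]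
      change ‖blockEmbed k x - blockEmbed k y‖ ≤ _
      rw [← blockEmbed_sub, norm_blockEmbed])
    (by
      refine Subtype.ext (norm_eq_zero.1 ?_)
      exact (norm_blockEmbed k 0).trans norm_zero)

theorem restrictBlock_apply (k : ℕ) (f : Lip0 gridEllOne gridZero) (x : gridEllOne) :
    restrictBlock k f x = f (gridEmbed k x) := one_mul _

/-- The sequence of restrictions of a function to all blocks. -/
def restrictBlockSeq : Lip0 gridEllOne gridZero →L[ℝ] (ℕ →ᵇ Lip0 gridEllOne gridZero) :=
  seqCLM restrictBlock 1 fun _ f => Lip0.norm_compCLM_le _ _ _ _ _ _ f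

theorem restrictBlockSeq_gluing (g : ℕ →ᵇ Lip0 gridEllOne gridZero) :
    restrictBlockSeq (gluing g) = g := by
  refine BoundedContinuousFunction.ext fun k => Lip0.ext fun x => ?_
  refine (restrictBlock_apply k (gluing g) x).trans ?_
  have hx : gridBlock k (gridEmbed k x) = x := Subtype.ext (block_blockEmbed_self k x)
  rw [gluing_apply, tsum_eq_single k fun j hj => ?_, hx]
  · rcases eq_or_ne x gridZero with rfl | h
    · rw [show g k gridZero = 0 from (g k).2.2, mul_zero]
    · have h' : (x : EllOne) ≠ 0 := fun h0 => h (Subtype.ext h0)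
      exact (congrArg (· * g k x) (weight_blockEmbed_self k h')).trans (one_mul _)
  · have h0 : block j (blockEmbed k x) = 0 := block_blockEmbed_of_ne hj x
    have : weight j (gridEmbed k x : EllOne) = 0 :=
      weight_eq_zero_of_le (by
        change 2 * ‖block j (blockEmbed k x)‖ ≤ _
        rw [h0, norm_zero, mul_zero]; exact norm_nonneg _)
    rw [this, zero_mul]

end EllOne

theorem theorem3p9 :
    Nonempty (Lip0 gridEllOne ⟨0, zero_mem_gridEllOne⟩ ≃L[ℝ] Lip0 EllOne 0) :=
  nonempty_equiv_of_complemented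
    EllOne.gluing EllOne.restrictBlockSeq EllOne.restrictBlockSeq_gluing
    EllOne.extendGrid EllOne.restrictGrid EllOne.restrictGrid_extendGrid
    EllOne.scaledRestrictSeq EllOne.limitExtend EllOne.limitExtend_scaledRestrictSeq

end
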